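/- Words are over the alphabet $\{0,1\}$; infinite words are one-sided, $w=w_0w_1w_2\cdots$, and a factor is a finite block of consecutive letters. A border of a finite word is a proper (possibly empty) prefix that is also a suffix. A finite word is closed if it has length at most $1$ or its longest border occurs in it exactly twice. An infinite word $w$ is closed-rich if there is a constant $C>0$ such that for each $n$ every factor of $w$ of length $n$ contains at least $Cn^2$ distinct closed factors. The exponent of a nonempty finite word $v$ is $|v|/t$, where $t\ge 1$ is the shortest period of $v$; an infinite word is of bounded exponent if the exponents of its nonempty factors have a finite supremum. An infinite word $w$ is uniformly recurrent if for each factor $u$ of $w$ there is $L$ such that every factor of $w$ of length $L$ contains $u$. The shift orbit closure of $w$ is the set of infinite words all of whose factors are factors of $w$. For $0<\varepsilon<1$, an infinite binary word $w$ is an $\varepsilon$-Beck word if there is an integer $N_\varepsilon\ge 0$ such that for every factor $x$ of $w$ of length $n>N_\varepsilon$, any two distinct occurrences of $x$ in $w$ are disjoint and separated by at least $(2-\varepsilon)^n$ letters (counted from the end of the earlier one to the beginning of the later one). Corollary. There exists an infinite uniformly recurrent word of bounded exponent which is not closed-rich. More precisely, for every real $\varepsilon$ with $0<\varepsilon<1$: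 (1) there exists an $\varepsilon$-Beck word; and for every $\varepsilon$-Beck word $w$: (2) $w$ is of bounded exponent; (3) every word in the shift orbit closure of $w$ is an $\varepsilon$-Beck word; (4) the shift orbit closure of $w$ contains a uniformly recurrent word; (5) every uniformly recurrent word in the shift orbit closure of $w$ is of bounded exponent and is not closed-rich. -/

import Mathlib

/-!  Finite words over `A` are lists, infinite words are functions `ℕ → A`.  -/

namespace CombWord

/-- The factor `w_i w_{i+1} ⋯ w_{i+n-1}` of the infinite word `w`. -/
def block {A : Type*} (w : ℕ → A) (i n : ℕ) : List A :=
  List.ofFn fun k : Fin n => w (i + k)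

/-- The finite word `v` is a factor of the infinite word `w`. -/
def IsFactor {A : Type*} (v : List A) (w : ℕ → A) : Prop :=
  ∃ i : ℕ, v = block w i v.length

/-- The set of positions at which the finite word `v` occurs in the finite word `w`. -/
def occurrences {A : Type*} (v w : List A) : Set ℕ :=
  {i | i ≤ w.length ∧ v <+: w.drop i}

/-- A border of `w` is a proper (possibly empty) prefix of `w` which is also a suffix of `w`. -/
def IsBorder {A : Type*} (v w : List A) : Prop :=
  v <+: w ∧ v <:+ w ∧ v.length < w.length

/-- A finite word is closed if it is empty or a letter, or if its longest border occurs in it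
exactly twice. -/
def IsClosedWord {A : Type*} (w : List A) : Prop :=
  w.length ≤ 1 ∨
    ∃ v : List A, IsBorder v w ∧ (∀ u : List A, IsBorder u w → u.length ≤ v.length) ∧
      (occurrences v w).ncard = 2

/-- The number of distinct closed factors of a finite word. -/
noncomputable def numClosedFactors {A : Type*} (w : List A) : ℕ :=
  {u : List A | u <:+: w ∧ IsClosedWord u}.ncard

/-- An infinite word is closed-rich if, for some constant `C > 0`, each of its factors of
length `n` contains at least `C * n ^ 2` distinct closed factors. -/
def IsClosedRich {A : Type*} (w : ℕ → A) : Prop :=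
  ∃ C : ℝ, 0 < C ∧ ∀ v : List A, IsFactor v w →
    C * (v.length : ℝ) ^ 2 ≤ (numClosedFactors v : ℝ)

/-- The shortest (positive) period of a finite word. -/
noncomputable def minPeriod {A : Type*} (v : List A) : ℕ :=
  sInf {t : ℕ | 0 < t ∧ v.HasPeriod t}

/-- The exponent of a finite word: its length divided by its shortest period. -/
noncomputable def exponent {A : Type*} (v : List A) : ℝ :=
  (v.length : ℝ) / (minPeriod v : ℝ)

/-- The exponents of the factors of the infinite word `w` have a finite supremum. -/
def HasBoundedExponent {A : Type*} (w : ℕ → A) : Prop :=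
  BddAbove {s : ℝ | ∃ v : List A, IsFactor v w ∧ s = exponent v}

/-- Each factor `u` of `w` occurs in all factors of `w` of some length `L = L(u)`. -/
def IsUniformlyRecurrent {A : Type*} (w : ℕ → A) : Prop :=
  ∀ u : List A, IsFactor u w →
    ∃ L : ℕ, ∀ v : List A, IsFactor v w → v.length = L → u <:+: v

/-- The shift orbit closure of `w`: the infinite words all of whose factors are factors
of `w`. -/
def orbitClosure {A : Type*} (w : ℕ → A) : Set (ℕ → A) :=
  {u | ∀ v : List A, IsFactor v u → IsFactor v w}

/-- A binary infinite word is `ε`-Beck if for some `N`, for all `n > N`, between the end of an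
occurrence of a factor of length `n` and the start of any later occurrence of the same factor
there are at least `(2 - ε) ^ n` letters. Overlapping occurrences have a negative value of
`j - (i + n)`, so they are excluded (when `ε < 2`). -/
def IsBeckWord (ε : ℝ) (w : ℕ → Bool) : Prop :=
  ∃ N : ℕ, ∀ n : ℕ, N < n → ∀ i j : ℕ, i < j → block w i n = block w j n →
    (2 - ε) ^ n ≤ (j : ℝ) - ((i : ℝ) + (n : ℝ))

end CombWord

open Filter Topology

namespace CombWord

section Blocks

variable {A : Type*}

/-! Write `β = 2 - ε`. Existence is a counting argument: if `B m` is the number of good words of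
length `m`, then `B (m + 1) ≥ α * B m` for a fixed `α` between `β` and 2. Each good word has two
one-letter extensions, and a bad one ends in a block of some length `n > N` that repeats at distance
`d < n + β ^ n`; given `d`, deleting that block loses no information (`ncard_repetitions_le`). By
induction the bad extensions number at most `B m * ∑ (n + β ^ n) / α ^ (n - 1)`, a series tail that
is small for large `N`. Compactness yields an infinite word.

The Beck condition passes to the orbit closure, and a minimal subshift inside it consists of
uniformly recurrent words. A factor of large exponent would contain overlapping occurrences of a
long word. A closed factor is determined by its starting position and border length; in a factor of
length `n` a long border of length `k` has `β ^ k ≤ n`, so there are only `O(n log n)` closed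
factors. -/

@[simp]
theorem length_block (w : ℕ → A) (i n : ℕ) : (block w i n).length = n := by
  simp [block]

theorem isFactor_block (w : ℕ → A) (i n : ℕ) : IsFactor (block w i n) w :=
  ⟨i, by simp⟩

theorem block_eq_block_iff {u w : ℕ → A} {i j n : ℕ} :
    block u i n = block w j n ↔ ∀ k < n, u (i + k) = w (j + k) := by
  unfold block
  rw [List.ofFn_inj]
  exact ⟨fun h k hk => congrFun h ⟨k, hk⟩, fun h => funext fun k => h k k.2⟩

theorem getElem?_block {w : ℕ → A} {i n k : ℕ} (hk : k < n) :
    (block w i n)[k]? = some (w (i + k)) := by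
  simp [block, hk]

theorem block_add (w : ℕ → A) (i m n : ℕ) :
    block w i (m + n) = block w i m ++ block w (i + m) n := by
  simp [block, List.ofFn_add, add_assoc]

theorem block_infix (w : ℕ → A) {i j m n : ℕ} (hij : i ≤ j) (h : j + n ≤ i + m) :
    block w j n <:+: block w i m := by
  obtain ⟨a, rfl⟩ := Nat.exists_eq_add_of_le hij
  obtain ⟨b, rfl⟩ := Nat.exists_eq_add_of_le (show a + n ≤ m by omega)
  exact ⟨block w i a, block w (i + (a + n)) b, by rw [block_add, block_add]⟩

theorem block_shift (w : ℕ → A) (i j n : ℕ) :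
    block (fun k => w (k + i)) j n = block w (j + i) n := by
  rw [block_eq_block_iff]
  intro k _
  exact congrArg w (by omega)

theorem mem_orbitClosure_iff {u w : ℕ → A} :
    u ∈ orbitClosure w ↔ ∀ i n, IsFactor (block u i n) w := by
  refine ⟨fun h i n => h _ (isFactor_block u i n), ?_⟩
  rintro h v ⟨i, hv⟩
  rw [hv]
  exact h i _

theorem self_mem_orbitClosure (w : ℕ → A) : w ∈ orbitClosure w := fun _ h => h

end Blocks

/-! ### Bounded exponent and passage to the orbit closure -/

section BoundedExponent

theorem minPeriod_mem {A : Type*} (v : List A) : minPeriod v ∈ {t : ℕ | 0 < t ∧ v.HasPeriod t} :=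
  Nat.sInf_mem ⟨v.length + 1, by omega, List.hasPeriod_of_length_le _ _ (by omega)⟩

theorem IsBeckWord.hasBoundedExponent {ε : ℝ} (hε : ε ≤ 2) {w : ℕ → Bool} (hw : IsBeckWord ε w) :
    HasBoundedExponent w := by
  obtain ⟨N, hN⟩ := hw
  refine ⟨N + 2, ?_⟩
  rintro _ ⟨v, ⟨i, hv⟩, rfl⟩
  obtain ⟨ht, hper⟩ := minPeriod_mem v
  unfold exponent
  set t := minPeriod v
  rw [List.hasPeriod_iff_getElem?] at hper
  rw [div_le_iff₀ (by exact_mod_cast ht)]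
  suffices h : v.length ≤ (N + 2) * t by exact_mod_cast h
  by_contra hlt
  have h1 : t + N < v.length := by nlinarith
  have h2 : 2 * t < v.length := by nlinarith
  -- Removing the first or the last `t` letters of `v` leaves the same word; its two occurrences
  -- overlap because `2 * t < v.length`.
  have key := hN (v.length - t) (by omega) i (i + t) (by omega) (by
    rw [block_eq_block_iff]
    intro k hk
    have h := hper k hk
    rw [hv, getElem?_block (by omega), getElem?_block (by omega)] at h
    rw [Option.some.inj h]
    exact congrArg w (by omega))
  have hnn : (0 : ℝ) ≤ (2 - ε) ^ (v.length - t) := pow_nonneg (by linarith) _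
  rw [Nat.cast_sub (by omega)] at key
  have h2' : (2 : ℝ) * t < v.length := by exact_mod_cast h2
  push_cast at key
  linarith

theorem IsBeckWord.of_mem_orbitClosure {ε : ℝ} {u w : ℕ → Bool} (hw : IsBeckWord ε w)
    (hu : u ∈ orbitClosure w) : IsBeckWord ε u := by
  obtain ⟨N, hN⟩ := hw
  refine ⟨N, fun n hn i j hij h => ?_⟩
  -- One factor of `u` covers both occurrences, so they reappear in `w` at the same distance.
  obtain ⟨p, hp⟩ := mem_orbitClosure_iff.1 hu i (j - i + n)
  rw [length_block, block_eq_block_iff] at hp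
  rw [block_eq_block_iff] at h
  have key := hN n hn p (p + (j - i)) (by omega) (by
    rw [block_eq_block_iff]
    intro k hk
    rw [← hp k (by omega), h k hk, add_assoc, ← hp _ (by omega)]
    exact congrArg u (by omega))
  push_cast [Nat.cast_sub hij.le] at key
  linarith

end BoundedExponent

/-! ### Minimal subshifts and uniform recurrence -/

section UniformRecurrence

theorem isClosed_setOf_block {A : Type*} [TopologicalSpace A] [DiscreteTopology A]
    (P : List A → Prop) (i n : ℕ) : IsClosed {u : ℕ → A | P (block u i n)} := by
  have hc : Continuous fun (u : ℕ → A) (k : Fin n) => u (i + k) := by fun_prop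
  exact (isClosed_discrete {g : Fin n → A | P (List.ofFn g)}).preimage hc

theorem isClosed_orbitClosure {A : Type*} [TopologicalSpace A] [DiscreteTopology A] (w : ℕ → A) :
    IsClosed (orbitClosure w) := by
  have : orbitClosure w = ⋂ (i : ℕ) (n : ℕ), {u | IsFactor (block u i n) w} := by
    ext u
    simp [mem_orbitClosure_iff]
  rw [this]
  exact isClosed_iInter fun i => isClosed_iInter fun n =>
    isClosed_setOf_block (fun v => IsFactor v w) i n

/-- The nonempty closed sets of infinite words that are stable under the shift. -/
def subshifts (A : Type*) [TopologicalSpace A] : Set (Set (ℕ → A)) :=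
  {X | X.Nonempty ∧ IsClosed X ∧ ∀ u ∈ X, (fun k => u (k + 1)) ∈ X}

variable {A : Type*} [TopologicalSpace A]

theorem shift_mem_of_mem_subshifts {X : Set (ℕ → A)} (hX : X ∈ subshifts A) {u : ℕ → A}
    (hu : u ∈ X) (i : ℕ) : (fun k => u (k + i)) ∈ X := by
  induction i with
  | zero => exact hu
  | succ i ih =>
    convert hX.2.2 _ ih using 2
    exact congrArg u (by omega)

theorem orbitClosure_mem_subshifts [DiscreteTopology A] (w : ℕ → A) :
    orbitClosure w ∈ subshifts A := by
  refine ⟨⟨w, self_mem_orbitClosure w⟩, isClosed_orbitClosure w, fun u hu => ?_⟩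
  rw [mem_orbitClosure_iff] at hu ⊢
  intro i n
  rw [block_shift]
  exact hu _ _

theorem exists_minimal_subshift [CompactSpace A] {X : Set (ℕ → A)} (hX : X ∈ subshifts A) :
    ∃ M ⊆ X, Minimal (· ∈ subshifts A) M := by
  refine zorn_superset_nonempty _ (fun c hc hchain hne => ?_) X hX
  refine ⟨⋂₀ c, ⟨?_, isClosed_sInter fun s hs => (hc hs).2.1, ?_⟩,
    fun s hs => Set.sInter_subset_of_mem hs⟩
  · have : Nonempty c := hne.to_subtype
    rw [Set.sInter_eq_iInter]
    refine IsCompact.nonempty_iInter_of_directed_nonempty_isCompact_isClosed _ ?_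
      (fun s => (hc s.2).1) (fun s => (hc s.2).2.1.isCompact) (fun s => (hc s.2).2.1)
    exact fun s t => (hchain.total s.2 t.2).elim (fun h => ⟨s, Set.Subset.rfl, h⟩)
      fun h => ⟨t, h, Set.Subset.rfl⟩
  · exact fun u hu s hs => (hc hs).2.2 u (hu s hs)

/-- If arbitrarily long factors of `x` avoid `u`, compactness makes the words of `M` avoiding `u` a
subshift; by minimality it is all of `M`, yet `x` contains `u`. -/
theorem isUniformlyRecurrent_of_minimal [CompactSpace A] [DiscreteTopology A] {M : Set (ℕ → A)}
    (hM : Minimal (· ∈ subshifts A) M) {x : ℕ → A} (hx : x ∈ M) : IsUniformlyRecurrent x := by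
  rintro u ⟨i, hu⟩
  by_contra! hcon
  let F (L : ℕ) : Set (ℕ → A) := M ∩ {y | ¬ u <:+: block y 0 L}
  have hF : ∀ L, IsClosed (F L) := fun L =>
    hM.prop.2.1.inter (isClosed_setOf_block (fun v => ¬ u <:+: v) 0 L)
  have hsub : (⋂ L, F L) ∈ subshifts A := by
    refine ⟨?_, isClosed_iInter hF, fun y hy => ?_⟩
    · refine IsCompact.nonempty_iInter_of_sequence_nonempty_isCompact_isClosed F ?_ ?_
        (hF 0).isCompact hF
      · exact fun L y hy => ⟨hy.1, fun h => hy.2 (h.trans (block_infix y le_rfl (by omega)))⟩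
      · intro L
        obtain ⟨v, ⟨j, hv⟩, hL, huv⟩ := hcon L
        refine ⟨_, shift_mem_of_mem_subshifts hM.prop hx j, ?_⟩
        change ¬ _
        rwa [block_shift, zero_add, ← hL, ← hv]
    · rw [Set.mem_iInter] at hy ⊢
      refine fun L => ⟨hM.prop.2.2 y (hy 0).1, fun h => (hy (L + 1)).2 ?_⟩
      rw [block_shift] at h
      exact h.trans (block_infix y (by omega) (by omega))
  have hle := hM.le_of_le hsub fun y hy => (Set.mem_iInter.1 hy 0).1
  refine (Set.mem_iInter.1 (hle hx) (i + u.length)).2 ?_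
  nth_rewrite 1 [hu]
  exact block_infix x (by omega) (by omega)

theorem exists_isUniformlyRecurrent_mem_orbitClosure [CompactSpace A] [DiscreteTopology A]
    (w : ℕ → A) : ∃ u ∈ orbitClosure w, IsUniformlyRecurrent u := by
  obtain ⟨M, hsub, hM⟩ := exists_minimal_subshift (orbitClosure_mem_subshifts w)
  obtain ⟨x, hx⟩ := hM.prop.1
  exact ⟨x, hsub hx, isUniformlyRecurrent_of_minimal hM hx⟩

end UniformRecurrence

/-! ### Counting closed factors -/

section ClosedFactors

variable {A : Type*}

theorem eq_block_of_append_eq_block {w : ℕ → A} {s u t : List A} {i n : ℕ}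
    (h : s ++ u ++ t = block w i n) : u = block w (i + s.length) u.length := by
  have hn : n = s.length + u.length + t.length := by
    simpa [add_assoc] using (congrArg List.length h).symm
  rw [hn, block_add, block_add] at h
  have h' := (List.append_inj h (by simp)).1
  exact (List.append_inj h' (by simp)).2

theorem IsFactor.of_infix {w : ℕ → A} {u v : List A} (huv : u <:+: v) (hv : IsFactor v w) :
    IsFactor u w := by
  obtain ⟨s, t, h⟩ := huv
  obtain ⟨i, hi⟩ := hv
  exact ⟨_, eq_block_of_append_eq_block (h.trans hi)⟩

theorem IsBorder.pair_subset_occurrences {u v : List A} (h : IsBorder v u) :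
    {0, u.length - v.length} ⊆ occurrences v u := by
  obtain ⟨hp, hs, hl⟩ := h
  rintro i (rfl | rfl)
  · exact ⟨by omega, hp⟩
  · refine ⟨by omega, ?_⟩
    rw [← List.suffix_iff_eq_drop.1 hs]

theorem finite_occurrences (v u : List A) : (occurrences v u).Finite :=
  (Set.finite_Iic u.length).subset fun _ hi => hi.1

theorem occurrences_mono_of_prefix {u u' v : List A} (h : u <+: u') :
    occurrences v u ⊆ occurrences v u' :=
  fun i hi => ⟨hi.1.trans h.length_le, hi.2.trans (h.drop i)⟩

/-- A closed word is determined among the prefixes of a word by the length of its border. -/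
theorem eq_of_prefix_of_border_length_eq {l u u' v v' : List A} (hu : u <+: l) (hu' : u' <+: l)
    (hv : IsBorder v u) (hv' : IsBorder v' u') (hc : (occurrences v u).ncard = 2)
    (hc' : (occurrences v' u').ncard = 2) (hlen : v.length = v'.length) : u = u' := by
  wlog hle : u.length ≤ u'.length generalizing u u' v v'
  · exact (this hu' hu hv' hv hc' hc hlen.symm (by omega)).symm
  have huu' := List.prefix_of_prefix_length_le hu hu' hle
  obtain rfl : v = v' :=
    (List.prefix_of_prefix_length_le (hv.1.trans huu') hv'.1 hlen.le).eq_of_length hlen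
  refine huu'.eq_of_length (le_antisymm hle ?_)
  by_contra! hlt
  have h1 := hv.2.2
  -- The end of the shorter word would give a third occurrence of the border in the longer one.
  have hsub : ({0, u.length - v.length, u'.length - v.length} : Set ℕ) ⊆ occurrences v u' := by
    rintro i (rfl | rfl | rfl)
    · exact hv'.pair_subset_occurrences (by simp)
    · exact occurrences_mono_of_prefix huu' (hv.pair_subset_occurrences (by simp))
    · exact hv'.pair_subset_occurrences (by simp)
  have h3 := Set.ncard_le_ncard hsub (finite_occurrences v u')
  rw [hc', Set.ncard_insert_of_notMem (by simp; omega), Set.ncard_pair (by omega)] at h3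
  omega

theorem IsClosedWord.exists_border {u : List A} (hu : IsClosedWord u) (hne : u ≠ []) :
    ∃ v, IsBorder v u ∧ (occurrences v u).ncard = 2 := by
  rcases hu with h | ⟨v, hv, -, hc⟩
  · have hlen : u.length = 1 := le_antisymm h (List.length_pos_iff.2 hne)
    refine ⟨[], ⟨List.nil_prefix, List.nil_suffix, by simp [hlen]⟩, ?_⟩
    have : occurrences [] u = {0, 1} := by
      ext i
      simp only [occurrences, hlen, List.nil_prefix, and_true, Set.mem_ofPred_eq,
        Set.mem_insert_iff, Set.mem_singleton_iff]
      omega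
    rw [this, Set.ncard_pair (by omega)]
  · exact ⟨v, hv, hc⟩

theorem numClosedFactors_le {w : List A} {K : ℕ}
    (hK : ∀ u v, u <:+: w → IsBorder v u → v.length ≤ K) :
    numClosedFactors w ≤ (w.length + 1) * (K + 1) + 1 := by
  set S : Set (List A) := {u | u <:+: w ∧ IsClosedWord u ∧ u ≠ []}
  have hex : ∀ u ∈ S, ∃ (i : ℕ) (v : List A), i ≤ w.length ∧ u <+: w.drop i ∧ IsBorder v u ∧
      (occurrences v u).ncard = 2 := by
    rintro u ⟨⟨s, t, h⟩, hc, hne⟩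
    obtain ⟨v, hv, h2⟩ := hc.exists_border hne
    refine ⟨s.length, v, ?_, ?_, hv, h2⟩
    · rw [← h]; simp
    · rw [← h]; simp
  choose! pos bord hpos hpre hbord hocc using hex
  let T : Finset (ℕ × ℕ) := Finset.range (w.length + 1) ×ˢ Finset.range (K + 1)
  have hmaps : ∀ u ∈ S, (pos u, (bord u).length) ∈ (T : Set (ℕ × ℕ)) := by
    intro u hu
    have h1 := hpos u hu
    have h2 := hK u _ hu.1 (hbord u hu)
    simp only [T, Finset.coe_product, Set.mem_prod, Finset.coe_range, Set.mem_Iio]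
    omega
  have hinj : Set.InjOn (fun u => (pos u, (bord u).length)) S := by
    intro u hu u' hu' h
    obtain ⟨h1, h2⟩ := Prod.mk.inj h
    exact eq_of_prefix_of_border_length_eq (hpre u hu) (h1 ▸ hpre u' hu') (hbord u hu)
      (hbord u' hu') (hocc u hu) (hocc u' hu') h2
  have hfin : S.Finite := Set.Finite.of_finite_image
    (T.finite_toSet.subset (Set.image_subset_iff.2 hmaps)) hinj
  have hcard := Set.ncard_le_ncard_of_injOn _ hmaps hinj T.finite_toSet
  rw [Set.ncard_coe_finset, Finset.card_product, Finset.card_range, Finset.card_range] at hcard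
  calc numClosedFactors w ≤ (insert [] S).ncard := by
        refine Set.ncard_le_ncard ?_ (hfin.insert _)
        rintro u ⟨h1, h2⟩
        by_cases hu : u = []
        · exact Or.inl hu
        · exact Or.inr ⟨h1, h2, hu⟩
    _ ≤ S.ncard + 1 := Set.ncard_insert_le _ _
    _ ≤ _ := by omega

theorem IsBeckWord.border_length_bound {ε : ℝ} {w : ℕ → Bool} (hw : IsBeckWord ε w) :
    ∃ N : ℕ, ∀ u v, IsFactor u w → IsBorder v u → N < v.length →
      (2 - ε) ^ v.length ≤ (u.length : ℝ) := by
  obtain ⟨N, hN⟩ := hw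
  refine ⟨N, ?_⟩
  rintro u v ⟨i, hu⟩ ⟨⟨t, ht⟩, ⟨s, hs⟩, hlt⟩ hv
  have h1 := eq_block_of_append_eq_block (s := []) (ht.trans hu)
  have h2 := eq_block_of_append_eq_block (t := []) ((List.append_nil _).trans (hs.trans hu))
  have hlen : s.length + v.length = u.length := by simp [← hs]
  have key := hN v.length hv i (i + s.length) (by omega) (by
    rw [← h2]; exact h1.symm)
  have hlen' : (s.length : ℝ) + v.length = u.length := by exact_mod_cast hlen
  push_cast at key
  have := Nat.cast_nonneg (α := ℝ) v.length
  linarith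

theorem IsBeckWord.not_isClosedRich {ε : ℝ} (hε : ε < 1) {w : ℕ → Bool} (hw : IsBeckWord ε w) :
    ¬ IsClosedRich w := by
  rintro ⟨C, hC, hrich⟩
  obtain ⟨N, hN⟩ := hw.border_length_bound
  set β : ℝ := 2 - ε
  have hβ : 1 < β := by linarith
  -- With `n = ⌊β ^ K⌋₊` no border exceeds `K`, so richness gives `C * n ≤ 3 * (K + 1) ≤ 6 * K`, and
  -- `β ^ K < n + 1` gives `C * β ^ K ≤ (6 + C) * K`. This fails for large `K`.
  have hbound : ∀ K : ℕ, N ≤ K → 1 ≤ K → C / (6 + C) ≤ (K : ℝ) ^ 1 / β ^ K := by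
    intro K hNK hK1
    set n := ⌊β ^ K⌋₊
    have hβK : 1 ≤ β ^ K := one_le_pow₀ hβ.le
    have hn1 : 1 ≤ n := Nat.le_floor (by simpa using hβK)
    have hnle : (n : ℝ) ≤ β ^ K := Nat.floor_le (by linarith)
    have hnlt : β ^ K < n + 1 := Nat.lt_floor_add_one _
    have h1 := hrich _ (isFactor_block w 0 n)
    have h2 : numClosedFactors (block w 0 n) ≤ (n + 1) * (K + 1) + 1 := by
      have h := numClosedFactors_le (w := block w 0 n) (K := K) (fun u v hu hv => by
        by_contra! hlt
        have h3 := hN u v ((isFactor_block w 0 n).of_infix hu) hv (by omega)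
        have h4 : (u.length : ℝ) ≤ n := by exact_mod_cast by simpa using hu.length_le
        have h5 : β ^ K < β ^ v.length := pow_lt_pow_right₀ hβ hlt
        linarith)
      simpa using h
    have h2' : (numClosedFactors (block w 0 n) : ℝ) ≤ (n + 1) * (K + 1) + 1 := by
      exact_mod_cast h2
    rw [length_block] at h1
    have hn1' : (1 : ℝ) ≤ n := by exact_mod_cast hn1
    have hK1' : (1 : ℝ) ≤ K := by exact_mod_cast hK1
    have h3 : C * n * n ≤ 3 * (K + 1) * n := by nlinarith
    have h4 : C * n ≤ 3 * (K + 1) := le_of_mul_le_mul_right h3 (by linarith)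
    rw [div_le_div_iff₀ (by linarith) (by linarith), pow_one]
    nlinarith
  have hlim := tendsto_pow_const_div_const_pow_of_one_lt 1 hβ
  have hlt := hlim.eventually_lt_const (show 0 < C / (6 + C) by positivity)
  obtain ⟨K, h1, h2, h3⟩ := (hlt.and ((eventually_ge_atTop N).and (eventually_ge_atTop 1))).exists
  exact absurd (hbound K h2 h3) (not_le.2 h1)

end ClosedFactors

/-! ### Existence of Beck words by counting -/

section Existence

/-- The prefix of length `m` of `w` satisfies the condition of `IsBeckWord`, with base `β`, on its
factors longer than `N`. -/
def BeckUpTo (β : ℝ) (N m : ℕ) (w : ℕ → Bool) : Prop :=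
  ∀ n, N < n → ∀ i j, i < j → j + n ≤ m → (∀ k < n, w (i + k) = w (j + k)) →
    β ^ n ≤ (j : ℝ) - ((i : ℝ) + (n : ℝ))

/-- The binary words of length `m`, continued by `false`. -/
def wordsUpTo (m : ℕ) : Set (ℕ → Bool) := {w | ∀ k, m ≤ k → w k = false}

/-- The binary words of length `m`, continued by `false`, that satisfy `BeckUpTo`. -/
def beckWords (β : ℝ) (N m : ℕ) : Set (ℕ → Bool) := {w | BeckUpTo β N m w ∧ w ∈ wordsUpTo m}

/-- Replaces the letters of `w` from position `m` on by `false`. -/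
def truncate (m : ℕ) (w : ℕ → Bool) : ℕ → Bool := fun k => if k < m then w k else false

theorem finite_wordsUpTo (m : ℕ) : (wordsUpTo m).Finite := by
  refine ((Finset.range m).powerset.finite_toSet.image
    fun (s : Finset ℕ) k => decide (k ∈ s)).subset fun w hw => ?_
  refine ⟨(Finset.range m).filter fun k => w k = true,
    Finset.mem_coe.2 (Finset.mem_powerset.2 (Finset.filter_subset _ _)), ?_⟩
  funext k
  by_cases hk : k < m
  · simp [hk]
  · simp [hk, hw k (by omega)]

theorem finite_beckWords (β : ℝ) (N m : ℕ) : (beckWords β N m).Finite :=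
  (finite_wordsUpTo m).subset fun _ h => h.2

variable {β : ℝ} {N m : ℕ} {u w : ℕ → Bool}

theorem BeckUpTo.mono {m' : ℕ} (h : BeckUpTo β N m w) (hm : m' ≤ m) : BeckUpTo β N m' w :=
  fun n hn i j hij hj => h n hn i j hij (hj.trans hm)

theorem BeckUpTo.congr (h : BeckUpTo β N m w) (huw : ∀ k < m, u k = w k) : BeckUpTo β N m u := by
  intro n hn i j hij hj heq
  refine h n hn i j hij hj fun k hk => ?_
  rw [← huw _ (by omega), ← huw _ (by omega)]
  exact heq k hk

theorem truncate_of_lt {k : ℕ} (hk : k < m) : truncate m w k = w k := if_pos hk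

theorem truncate_mem_beckWords (h : BeckUpTo β N m w) : truncate m w ∈ beckWords β N m :=
  ⟨h.congr fun _ hk => truncate_of_lt hk, fun _ hk => if_neg (by omega)⟩

/-- The extensions by one letter of the words in `beckWords β N m`. -/
def extensions (β : ℝ) (N m : ℕ) : Set (ℕ → Bool) := {w | BeckUpTo β N m w ∧ w ∈ wordsUpTo (m + 1)}

theorem finite_extensions (β : ℝ) (N m : ℕ) : (extensions β N m).Finite :=
  (finite_wordsUpTo (m + 1)).subset fun _ h => h.2

theorem two_mul_ncard_beckWords_le (β : ℝ) (N m : ℕ) :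
    2 * (beckWords β N m).ncard ≤ (extensions β N m).ncard := by
  have h := Set.ncard_le_ncard_of_injOn (s := beckWords β N m ×ˢ (Set.univ : Set Bool))
    (t := extensions β N m) (fun p => Function.update p.1 m p.2) ?_ ?_ (finite_extensions β N m)
  · rwa [Set.ncard_prod, Set.ncard_univ, Nat.card_eq_fintype_card, Fintype.card_bool, mul_comm] at h
  · rintro ⟨w, a⟩ ⟨⟨h1, h2⟩, -⟩
    refine ⟨h1.congr fun k hk => Function.update_of_ne (by omega) _ _, fun k hk => ?_⟩
    exact (Function.update_of_ne (by omega) _ _).trans (h2 k (by omega))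
  · rintro ⟨w, a⟩ ⟨⟨-, hw⟩, -⟩ ⟨w', a'⟩ ⟨⟨-, hw'⟩, -⟩ h
    have h : Function.update w m a = Function.update w' m a' := h
    refine Prod.ext (funext fun k => ?_) ?_
    · by_cases hk : k = m
      · subst hk
        exact (hw k le_rfl).trans (hw' k le_rfl).symm
      · simpa [hk] using congrFun h k
    · simpa using congrFun h m

/-- The extensions whose last `n` letters repeat those found `d` positions earlier. -/
def repetitions (β : ℝ) (N m n d : ℕ) : Set (ℕ → Bool) :=
  {w ∈ extensions β N m | d + n ≤ m + 1 ∧ ∀ k, m + 1 ≤ k + n → k < m + 1 → w k = w (k - d)}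

/-- The last `n` letters are recovered from left to right, each copied from `d` places before, even
when `d < n`. -/
theorem ncard_repetitions_le (β : ℝ) (N m : ℕ) {n d : ℕ} (hn : 0 < n) (hd : 0 < d) :
    (repetitions β N m n d).ncard ≤ (beckWords β N (m + 1 - n)).ncard := by
  refine Set.ncard_le_ncard_of_injOn (truncate (m + 1 - n)) ?_ ?_ (finite_beckWords _ _ _)
  · exact fun w hw => truncate_mem_beckWords (hw.1.1.mono (by omega))
  · rintro w ⟨⟨-, hw⟩, hle, hrep⟩ w' ⟨⟨-, hw'⟩, -, hrep'⟩ h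
    funext k
    induction k using Nat.strong_induction_on with
    | _ k ih =>
      by_cases h1 : k < m + 1 - n
      · rw [← truncate_of_lt (w := w) h1, ← truncate_of_lt (w := w') h1, h]
      by_cases h2 : k < m + 1
      · rw [hrep k (by omega) h2, hrep' k (by omega) h2]
        exact ih _ (by omega)
      · rw [hw k (by omega), hw' k (by omega)]

theorem extensions_subset (β : ℝ) (N m : ℕ) :
    extensions β N m ⊆ beckWords β N (m + 1) ∪
      ⋃ n ∈ Finset.Ioc N (m + 1), ⋃ d ∈ Finset.Ico 1 ⌈n + β ^ n⌉₊, repetitions β N m n d := by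
  intro w hw
  by_cases hB : BeckUpTo β N (m + 1) w
  · exact Or.inl ⟨hB, hw.2⟩
  · refine Or.inr ?_
    simp only [BeckUpTo] at hB
    push Not at hB
    obtain ⟨n, hn, i, j, hij, hj, heq, hlt⟩ := hB
    -- The first `m` letters are good, so a violation must use the last letter.
    have hjm : j + n = m + 1 := by
      by_contra hne
      exact absurd (hw.1 n hn i j hij (by omega) heq) (not_le.2 hlt)
    simp only [Set.mem_iUnion, Finset.mem_Ioc, Finset.mem_Ico]
    refine ⟨n, ⟨hn, by omega⟩, j - i, ⟨by omega, ?_⟩, hw, by omega, fun k hk1 hk2 => ?_⟩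
    · rw [Nat.lt_ceil, Nat.cast_sub hij.le]
      linarith
    · have h := heq (k - j) (by omega)
      rw [show j + (k - j) = k by omega, show i + (k - j) = k - (j - i) by omega] at h
      exact h.symm

theorem two_mul_ncard_beckWords_le_add_sum (hβ : 0 ≤ β) (N m : ℕ) :
    2 * ((beckWords β N m).ncard : ℝ) ≤ (beckWords β N (m + 1)).ncard +
      ∑ n ∈ Finset.Ioc N (m + 1), (n + β ^ n) * ((beckWords β N (m + 1 - n)).ncard : ℝ) := by
  have hrep : ∀ n, N < n → (⋃ d ∈ Finset.Ico 1 ⌈n + β ^ n⌉₊, repetitions β N m n d).ncard ≤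
      (⌈n + β ^ n⌉₊ - 1) * (beckWords β N (m + 1 - n)).ncard := by
    intro n hn
    refine (Finset.set_ncard_biUnion_le _ _).trans ?_
    refine (Finset.sum_le_card_nsmul _ _ (beckWords β N (m + 1 - n)).ncard fun d hd => ?_).trans ?_
    · exact ncard_repetitions_le β N m (by omega) (Finset.mem_Ico.1 hd).1
    · simp
  have h1 : 2 * (beckWords β N m).ncard ≤ (beckWords β N (m + 1)).ncard +
      ∑ n ∈ Finset.Ioc N (m + 1), (⌈n + β ^ n⌉₊ - 1) * (beckWords β N (m + 1 - n)).ncard := by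
    refine (two_mul_ncard_beckWords_le β N m).trans ?_
    refine (Set.ncard_le_ncard (extensions_subset β N m) ?_).trans ?_
    · refine (finite_beckWords _ _ _).union ?_
      refine (finite_extensions β N m).subset ?_
      simp only [Set.iUnion_subset_iff]
      exact fun n _ d _ w hw => hw.1
    · refine (Set.ncard_union_le _ _).trans (Nat.add_le_add_left ?_ _)
      refine (Finset.set_ncard_biUnion_le _ _).trans ?_
      exact Finset.sum_le_sum fun n hn => hrep n (Finset.mem_Ioc.1 hn).1
  have h2 : 2 * ((beckWords β N m).ncard : ℝ) ≤ (beckWords β N (m + 1)).ncard +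
      ∑ n ∈ Finset.Ioc N (m + 1),
        ((⌈n + β ^ n⌉₊ - 1 : ℕ) : ℝ) * ((beckWords β N (m + 1 - n)).ncard : ℝ) := by
    exact_mod_cast h1
  refine h2.trans (add_le_add_right (Finset.sum_le_sum fun n hn => ?_) _)
  refine mul_le_mul_of_nonneg_right ?_ (Nat.cast_nonneg _)
  have hpos : 0 ≤ (n : ℝ) + β ^ n := by positivity
  have hlt := Nat.ceil_lt_add_one hpos
  have hc : 1 ≤ ⌈(n : ℝ) + β ^ n⌉₊ := by
    have : 0 < n := by have := (Finset.mem_Ioc.1 hn).1; omega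
    exact Nat.one_le_ceil_iff.2 (by positivity)
  rw [Nat.cast_sub hc, Nat.cast_one]
  linarith

/-- The full series converges since `1 < α` and `β < α`, so its tails vanish. -/
theorem exists_sum_Ioc_le {α δ : ℝ} (hβ : 0 ≤ β) (hα : 1 < α) (hβα : β < α) (hδ : 0 < δ) :
    ∃ N : ℕ, ∀ m, ∑ n ∈ Finset.Ioc N m, (n + β ^ n) / α ^ (n - 1) ≤ δ := by
  have hα0 : 0 < α := by linarith
  have hs1 : Summable fun n : ℕ => (n : ℝ) ^ 1 * α⁻¹ ^ n :=
    summable_pow_mul_geometric_of_norm_lt_one 1 (by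
      rw [Real.norm_of_nonneg (by positivity)]
      exact inv_lt_one_of_one_lt₀ hα)
  have hs2 : Summable fun n : ℕ => (β / α) ^ n :=
    summable_geometric_of_lt_one (by positivity) ((div_lt_one hα0).2 hβα)
  obtain ⟨s, hs⟩ := summable_iff_vanishing_norm.1 ((hs1.add hs2).mul_left α) δ hδ
  refine ⟨s.sup id, fun m => ?_⟩
  have hdisj : Disjoint (Finset.Ioc (s.sup id) m) s := by
    refine Finset.disjoint_left.2 fun n hn hns => ?_
    have h1 : n ≤ s.sup id := Finset.le_sup (f := id) hns
    have h2 := (Finset.mem_Ioc.1 hn).1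
    omega
  refine le_trans (le_of_eq (Finset.sum_congr rfl fun n hn => ?_))
    ((Real.le_norm_self _).trans (hs _ hdisj).le)
  obtain ⟨k, rfl⟩ : ∃ k, n = k + 1 := ⟨n - 1, by have := (Finset.mem_Ioc.1 hn).1; omega⟩
  rw [Nat.add_sub_cancel, div_pow, inv_pow, pow_succ α k, pow_one]
  field_simp

theorem le_ncard_beckWords_succ {α : ℝ} (hβ : 0 ≤ β) (hα : 0 < α)
    (hN : ∀ m, ∑ n ∈ Finset.Ioc N m, (n + β ^ n) / α ^ (n - 1) ≤ 2 - α) (m : ℕ) :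
    α * ((beckWords β N m).ncard : ℝ) ≤ (beckWords β N (m + 1)).ncard := by
  induction m using Nat.strong_induction_on with
  | _ m ih =>
    -- Iterating the induction hypothesis bounds earlier counts by the current one; it is used with
    -- `k = n - 1`.
    have hgrow : ∀ k ≤ m, α ^ k * ((beckWords β N (m - k)).ncard : ℝ) ≤
        (beckWords β N m).ncard := by
      intro k
      induction k with
      | zero => simp
      | succ k ihk =>
        intro hk
        refine le_trans ?_ (ihk (by omega))
        have h := ih (m - (k + 1)) (by omega)
        rw [show m - (k + 1) + 1 = m - k by omega] at h
        rw [pow_succ, mul_assoc]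
        exact mul_le_mul_of_nonneg_left h (by positivity)
    have hsum : ∑ n ∈ Finset.Ioc N (m + 1),
        (n + β ^ n) * ((beckWords β N (m + 1 - n)).ncard : ℝ) ≤
        (2 - α) * (beckWords β N m).ncard := by
      refine le_trans ?_ (mul_le_mul_of_nonneg_right (hN (m + 1)) (Nat.cast_nonneg _))
      rw [Finset.sum_mul]
      refine Finset.sum_le_sum fun n hn => ?_
      obtain ⟨h1, h2⟩ := Finset.mem_Ioc.1 hn
      have h := hgrow (n - 1) (by omega)
      rw [show m - (n - 1) = m + 1 - n by omega, mul_comm, ← le_div_iff₀ (by positivity)] at h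
      rw [div_mul_eq_mul_div, mul_div_assoc]
      exact mul_le_mul_of_nonneg_left h (by positivity)
    have := two_mul_ncard_beckWords_le_add_sum hβ N m
    linarith

theorem exists_forall_beckWords_nonempty (hβ : 1 ≤ β) (hβ2 : β < 2) :
    ∃ N, ∀ m, (beckWords β N m).Nonempty := by
  obtain ⟨α, hα1, hα2⟩ := exists_between hβ2
  obtain ⟨N, hN⟩ := exists_sum_Ioc_le (δ := 2 - α) (by linarith) (by linarith) hα1 (by linarith)
  have hα : 0 < α := by linarith
  refine ⟨N, fun m => ?_⟩
  induction m with
  | zero =>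
    exact ⟨fun _ => false, fun n hn i j hij hj => by omega, fun _ _ => rfl⟩
  | succ m ih =>
    have h := le_ncard_beckWords_succ (by linarith) hα hN m
    rw [← Set.ncard_pos (finite_beckWords _ _ _)] at ih ⊢
    have h1 : (0 : ℝ) < (beckWords β N m).ncard := by exact_mod_cast ih
    have h2 : (0 : ℝ) < (beckWords β N (m + 1)).ncard := (mul_pos hα h1).trans_le h
    exact_mod_cast h2

/-- The condition depends only on the first `m` letters. -/
theorem isClosed_setOf_beckUpTo (β : ℝ) (N m : ℕ) : IsClosed {w | BeckUpTo β N m w} := by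
  have : {w | BeckUpTo β N m w} =
      {w | (fun v => ∃ w', BeckUpTo β N m w' ∧ v = block w' 0 m) (block w 0 m)} := by
    ext w
    refine ⟨fun h => ⟨w, h, rfl⟩, ?_⟩
    rintro ⟨w', h, heq⟩
    rw [block_eq_block_iff] at heq
    exact h.congr fun k hk => by simpa using heq k hk
  rw [this]
  exact isClosed_setOf_block (fun v => ∃ w', BeckUpTo β N m w' ∧ v = block w' 0 m) 0 m

theorem exists_isBeckWord {ε : ℝ} (hε0 : 0 < ε) (hε1 : ε ≤ 1) :
    ∃ w : ℕ → Bool, IsBeckWord ε w := by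
  obtain ⟨N, hN⟩ := exists_forall_beckWords_nonempty (β := 2 - ε) (by linarith) (by linarith)
  obtain ⟨w, hw⟩ := IsCompact.nonempty_iInter_of_sequence_nonempty_isCompact_isClosed
    (fun m => {w | BeckUpTo (2 - ε) N m w}) (fun m w h => BeckUpTo.mono h (Nat.le_succ m))
    (fun m => (hN m).mono fun _ h => h.1) (isClosed_setOf_beckUpTo _ _ _).isCompact
    (isClosed_setOf_beckUpTo _ _)
  rw [Set.mem_iInter] at hw
  exact ⟨w, N, fun n hn i j hij h =>
    hw (j + n) n hn i j hij le_rfl (block_eq_block_iff.1 h)⟩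

end Existence

end CombWord

theorem mainTheorem7 :
    (∃ w : ℕ → Bool, CombWord.IsUniformlyRecurrent w ∧ CombWord.HasBoundedExponent w ∧
      ¬ CombWord.IsClosedRich w) ∧
    ∀ ε : ℝ, 0 < ε → ε < 1 →
      (∃ w : ℕ → Bool, CombWord.IsBeckWord ε w) ∧
      ∀ w : ℕ → Bool, CombWord.IsBeckWord ε w →
        CombWord.HasBoundedExponent w ∧
        (∀ u ∈ CombWord.orbitClosure w, CombWord.IsBeckWord ε u) ∧
        (∃ u ∈ CombWord.orbitClosure w, CombWord.IsUniformlyRecurrent u) ∧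
        (∀ u ∈ CombWord.orbitClosure w, CombWord.IsUniformlyRecurrent u →
          CombWord.HasBoundedExponent u ∧ ¬ CombWord.IsClosedRich u) := by
  have main : ∀ ε : ℝ, 0 < ε → ε < 1 →
      (∃ w : ℕ → Bool, CombWord.IsBeckWord ε w) ∧
      ∀ w : ℕ → Bool, CombWord.IsBeckWord ε w →
        CombWord.HasBoundedExponent w ∧
        (∀ u ∈ CombWord.orbitClosure w, CombWord.IsBeckWord ε u) ∧
        (∃ u ∈ CombWord.orbitClosure w, CombWord.IsUniformlyRecurrent u) ∧
        (∀ u ∈ CombWord.orbitClosure w, CombWord.IsUniformlyRecurrent u →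
          CombWord.HasBoundedExponent u ∧ ¬ CombWord.IsClosedRich u) := by
    intro ε h0 h1
    refine ⟨CombWord.exists_isBeckWord h0 h1.le, fun w hw => ?_⟩
    have hcl : ∀ u ∈ CombWord.orbitClosure w, CombWord.IsBeckWord ε u :=
      fun u hu => hw.of_mem_orbitClosure hu
    exact ⟨hw.hasBoundedExponent (by linarith), hcl,
      CombWord.exists_isUniformlyRecurrent_mem_orbitClosure w,
      fun u hu _ => ⟨(hcl u hu).hasBoundedExponent (by linarith), (hcl u hu).not_isClosedRich h1⟩⟩
  refine ⟨?_, main⟩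
  obtain ⟨⟨w, hw⟩, h⟩ := main (1 / 2) (by norm_num) (by norm_num)
  obtain ⟨-, -, ⟨u, hu, hrec⟩, hall⟩ := h w hw
  exact ⟨u, hrec, hall u hu hrec⟩
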